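/- For positive integers $k,n$ let $[k]=\{1,\dots,k\}$ and $[k]^n$ the set of $n$-tuples with entries in $[k]$. A combinatorial line in $[k]^n$ is a set $\{u_1,\dots,u_k\}\subseteq[k]^n$ for which there is a partition $\{1,\dots,n\}=C\cup M$ with $M\neq\varnothing$ such that, for each $c\in C$, the points $u_1,\dots,u_k$ all have the same $c$-th entry and, for each $m\in M$ and $i\in[k]$, the $m$-th entry of $u_i$ is $i$. A quasiline in $[k]^n$ is a $k$-element set $L\subseteq[k]^n$ such that for every $\nu\in\{1,\dots,n\}$ the $\nu$-th entries of the points of $L$ are either all identical or mutually distinct. **Theorem.** For all integers $k\ge 3$ and $r\ge 1$ and all reals $\mu\in\left(0,\frac{k-1}{k}\right)$ there exist an integer $n\ge 1$ and a set $\mathcal X\subseteq[k]^n$ such that 1. for every colouring $\gamma\colon\mathcal X\to\{1,\dots,r\}$ there is a combinatorial line $L\subseteq\mathcal X$ on which $\gamma$ is constant; 2. every $\mathcal Y\subseteq\mathcal X$ has a subset $\mathcal Z\subseteq\mathcal Y$ with $|\mathcal Z|\ge\mu|\mathcal Y|$ such that no quasiline is contained in $\mathcal Z$; 3. every quasiline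 $L\subseteq\mathcal X$ is a combinatorial line. -/

import Mathlib

/-- A set `L` of points of the Hales-Jewett cube `[k]^n` (modelled as `Fin n → Fin k`) is a
combinatorial line if it is the image of a combinatorial embedding: some coordinates (at least one)
are moving and the others are constant. -/
def IsCombinatorialLine {k n : ℕ} (L : Finset (Fin n → Fin k)) : Prop :=
  ∃ ℓ : Combinatorics.Line (Fin k) (Fin n), (L : Set (Fin n → Fin k)) = Set.range ℓ

/-- A quasiline in `[k]^n` is a set of exactly `k` points such that in every coordinate direction
the entries of its points are either all identical or mutually distinct. -/
def IsQuasiline {k n : ℕ} (L : Finset (Fin n → Fin k)) : Prop :=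
  L.card = k ∧
    ∀ ν : Fin n,
      (∀ x ∈ L, ∀ y ∈ L, x ν = y ν) ∨ (∀ x ∈ L, ∀ y ∈ L, x ≠ y → x ν ≠ y ν)

/-! The points of the set are labelled by the vertices of an auxiliary ordered `k`-uniform
hypergraph, in such a way that every quasiline is a combinatorial line whose labels form an edge.
The hypergraph (`exists_fractional_hypergraph`) has large chromatic number but random transversals
that miss each vertex with probability at least `μ`. Deleting from `Y` the points labelled by a
random transversal keeps on average a proportion `μ` and destroys every quasiline.

The hypergraph is a shift hypergraph: vertices are long tuples, and edges are `k` consecutive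
windows of an increasing sequence. A transversal comes from a random ordering of the ground set: a
window is selected if its minimum sits at a position divisible by `k` or near an end. As the window
slides, the minimum drifts through the residues mod `k`, so some window is selected, while each
window is selected with probability only about `1/k`.

The labelled set comes from the partite construction (`exists_ramsey_picture`). It starts with
disjoint lines, one per edge, and treats the labels one at a time. For a label `v`, copies of the
current set are glued along the lines of a Hales-Jewett cube whose alphabet is the set of points
labelled `v` (`exists_amalgamation`). To create no unwanted quasilines only a sparse family of these
lines is used (`exists_sparse_lines`). -/

/-! ### Ramsey property of shift hypergraphs. -/

/-- Ramsey property of consecutive windows: if the tuples of length `m + 1` of natural numbers are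
coloured with finitely many colours, some increasing sequence below a bound depending only on the
number of colours has `L + 1` consecutive windows of the same colour. -/
theorem exists_monochromatic_windows (m : ℕ) :
    ∀ (κ : Type) [Fintype κ] (L : ℕ), ∃ G : ℕ, ∀ c : (Fin (m + 1) → ℕ) → κ,
      ∃ z : ℕ → ℕ, (∀ a, a + 1 < m + 1 + L → z a < z (a + 1)) ∧ (∀ a < m + 1 + L, z a < G) ∧
        ∃ i, ∀ j ≤ L, c (fun a => z (j + a)) = i := by
  classical
  induction m with
  | zero =>
    intro κ _ L
    refine ⟨Fintype.card κ * L + 1, fun c => ?_⟩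
    obtain ⟨i, -, hi⟩ := Finset.exists_lt_card_fiber_of_mul_lt_card_of_maps_to
      (s := Finset.range (Fintype.card κ * L + 1)) (t := Finset.univ)
      (f := fun x => c (fun _ => x)) (n := L) (fun _ _ => Finset.mem_univ _) (by simp)
    obtain ⟨s, hs, hcard⟩ := Finset.exists_subset_card_eq (Nat.succ_le_of_lt hi)
    let e := s.orderEmbOfFin hcard
    have hmem : ∀ j, e j ∈ s := fun j => s.orderEmbOfFin_mem hcard j
    refine ⟨fun a => if h : a < L.succ then e ⟨a, h⟩ else 0, ?_, ?_, i, ?_⟩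
    · intro a ha
      have h1 : a + 1 < L.succ := by omega
      have h2 : a < L.succ := by omega
      simp only [h1, h2, dif_pos]
      exact e.strictMono (by simp [Fin.lt_def])
    · intro a ha
      have h2 : a < L.succ := by omega
      simp only [h2, dif_pos]
      have := hs (hmem ⟨a, h2⟩)
      simp only [Finset.mem_filter, Finset.mem_range] at this
      exact this.1
    · intro j hj
      have h2 : j < L.succ := by omega
      have := hs (hmem ⟨j, h2⟩)
      simp only [Finset.mem_filter, Finset.mem_range] at this
      rw [← this.2]
      congr 1
      funext a
      have : (a : ℕ) = 0 := by omega
      simp [h2]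
  | succ m ih =>
    intro κ _ L
    obtain ⟨G, hG⟩ := ih (κ → Fin (L + 1)) 1
    refine ⟨G, fun c => ?_⟩
    let P : κ → ℕ → (Fin (m + 1) → ℕ) → Prop := fun i s t =>
      ∃ z : ℕ → ℕ, (∀ a, a + 1 < m + 1 + s → z a < z (a + 1)) ∧ (∀ a < m + 1 + s, z a < G) ∧
        (∀ j < s, c (fun a => z (j + a)) = i) ∧ ∀ a : Fin (m + 1), t a = z (s + a)
    by_contra hno
    have hP : ∀ i t, ¬ P i (L + 1) t := by
      rintro i t ⟨z, h1, h2, h3, -⟩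
      exact hno ⟨z, fun a ha => h1 a (by omega), fun a ha => h2 a (by omega), i,
        fun j hj => h3 j (by omega)⟩
    -- A tuple is coloured by recording, for each colour `i`, the longest chain of `i`-coloured
    -- windows ending in it, capped at `L`.
    obtain ⟨x, hx1, hx2, f, hf⟩ := hG fun t i =>
      ⟨Nat.findGreatest (fun s => P i s t) L, Nat.lt_succ_of_le (Nat.findGreatest_le L)⟩
    let t₀ : Fin (m + 1) → ℕ := fun a => x (0 + a)
    let t₁ : Fin (m + 1) → ℕ := fun a => x (1 + a)
    let i := c fun a => x a
    have heq : Nat.findGreatest (fun s => P i s t₀) L = Nat.findGreatest (fun s => P i s t₁) L := by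
      have := congrFun ((hf 0 (by omega)).trans (hf 1 le_rfl).symm) i
      exact congrArg Fin.val this
    have h0 : P i 0 t₀ := ⟨x, fun a ha => hx1 a (by omega), fun a ha => hx2 a (by omega),
      fun j hj => by omega, fun a => rfl⟩
    obtain ⟨z, hz1, hz2, hz3, hz4⟩ := Nat.findGreatest_spec (P := fun s => P i s t₀) (Nat.zero_le L) h0
    set s := Nat.findGreatest (fun s => P i s t₀) L with hs
    have hz4' : ∀ a, a < m + 1 → z (s + a) = x a := by
      intro a ha
      have := hz4 ⟨a, ha⟩
      simpa [t₀] using this.symm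
    -- The window `x` has colour `i` and prolongs every `i`-chain ending in `t₀` to one ending in
    -- `t₁`. Equal records are then possible only at the cap `s = L`, where the prolonged chain has
    -- `L + 1` windows.
    have hnew : P i (s + 1) t₁ := by
      refine ⟨fun a => if a < m + 1 + s then z a else x (m + 1), ?_, ?_, ?_, ?_⟩
      · intro a ha
        have h2 : a < m + 1 + s := by omega
        by_cases h1 : a + 1 < m + 1 + s
        · simpa [h1, h2] using hz1 a h1
        · have h3 : a = s + m := by omega
          simp only [h1, h2, if_true, if_false]
          rw [h3, hz4' m (by omega)]
          exact hx1 m (by omega)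
      · intro a ha
        by_cases h1 : a < m + 1 + s
        · simpa [h1] using hz2 a h1
        · simpa [h1] using hx2 (m + 1) (by omega)
      · intro j hj
        by_cases h1 : j < s
        · rw [← hz3 j h1]
          congr 1
          funext a
          have : j + (a : ℕ) < m + 1 + s := by omega
          simp [this]
        · have h2 : j = s := by omega
          rw [h2]
          change _ = c fun a => x a
          congr 1
          funext a
          by_cases h3 : (a : ℕ) < m + 1
          · have h4 : s + (a : ℕ) < m + 1 + s := by omega
            simpa [h4] using hz4' a h3
          · have h4 : (a : ℕ) = m + 1 := by omega
            have h5 : ¬ s + (m + 1) < m + 1 + s := by omega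
            simp [h4, h5]
      · intro a
        change x (1 + a) = _
        by_cases h3 : 1 + (a : ℕ) < m + 1
        · have h4 : s + 1 + (a : ℕ) < m + 1 + s := by omega
          simp only [h4, if_true]
          rw [← hz4' _ h3, add_assoc]
        · have h4 : 1 + (a : ℕ) = m + 1 := by omega
          have h5 : ¬ s + 1 + (a : ℕ) < m + 1 + s := by omega
          simp [h4, h5]
    have hle : s ≤ L := Nat.findGreatest_le L
    by_cases hsL : s + 1 ≤ L
    · have := Nat.le_findGreatest (P := fun s => P i s t₁) hsL hnew
      omega
    · have : s = L := by omega
      exact hP i t₁ (this ▸ hnew)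

/-! ### Random orderings and the fractional hypergraph. -/

/-- `p` is the position at which `σ` takes its minimum on the tuple `v`. -/
def IsArgmin {m G : ℕ} (σ : Equiv.Perm (Fin G)) (v : Fin m ↪ Fin G) (p : Fin m) : Prop :=
  ∀ q, σ (v p) ≤ σ (v q)

theorem IsArgmin.unique {m G : ℕ} {σ : Equiv.Perm (Fin G)} {v : Fin m ↪ Fin G} {p q : Fin m}
    (hp : IsArgmin σ v p) (hq : IsArgmin σ v q) : p = q :=
  v.injective (σ.injective (le_antisymm (hp q) (hq p)))

theorem exists_isArgmin {m G : ℕ} (hm : 0 < m) (σ : Equiv.Perm (Fin G)) (v : Fin m ↪ Fin G) :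
    ∃ p, IsArgmin σ v p := by
  have : Nonempty (Fin m) := ⟨⟨0, hm⟩⟩
  exact Finite.exists_min fun q => σ (v q)

-- Precomposition with the transposition of `v p` and `v q` carries orderings with minimum at `p`
-- injectively to orderings with minimum at `q`.
open Classical in
theorem card_isArgmin_le {m G : ℕ} (v : Fin m ↪ Fin G) (p q : Fin m) :
    (Finset.univ.filter fun σ : Equiv.Perm (Fin G) => IsArgmin σ v p).card ≤
      (Finset.univ.filter fun σ : Equiv.Perm (Fin G) => IsArgmin σ v q).card := by
  refine Finset.card_le_card_of_injOn (fun σ => σ * Equiv.swap (v p) (v q)) ?_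
    (fun _ _ _ _ h => mul_right_cancel h)
  intro σ hσ
  simp only [Finset.coe_filter, Finset.mem_univ, true_and, Set.mem_ofPred_eq] at hσ ⊢
  have hsw : ∀ a, Equiv.swap (v p) (v q) (v a) = v (Equiv.swap p q a) := fun a =>
    (v.injective.map_swap p q a).symm
  intro a
  simp only [Equiv.Perm.mul_apply, hsw, Equiv.swap_apply_right]
  exact hσ _

open Classical in
/-- The position of the minimum of a random permutation on a tuple is equidistributed. -/
theorem card_mul_card_isArgmin_mem {m G : ℕ} (hm : 0 < m) (v : Fin m ↪ Fin G)
    (S : Finset (Fin m)) :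
    m * (Finset.univ.filter fun σ : Equiv.Perm (Fin G) => ∃ p ∈ S, IsArgmin σ v p).card =
      S.card * Fintype.card (Equiv.Perm (Fin G)) := by
  let N : Fin m → ℕ := fun p =>
    (Finset.univ.filter fun σ : Equiv.Perm (Fin G) => IsArgmin σ v p).card
  let p₀ : Fin m := ⟨0, hm⟩
  have hN : ∀ p, N p = N p₀ := fun p => le_antisymm (card_isArgmin_le v _ _) (card_isArgmin_le v _ _)
  have key : ∀ T : Finset (Fin m),
      (Finset.univ.filter fun σ : Equiv.Perm (Fin G) => ∃ p ∈ T, IsArgmin σ v p).card =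
        T.card * N p₀ := by
    intro T
    have : (Finset.univ.filter fun σ : Equiv.Perm (Fin G) => ∃ p ∈ T, IsArgmin σ v p) =
        T.biUnion fun p => Finset.univ.filter fun σ => IsArgmin σ v p := by
      ext σ; simp
    rw [this, Finset.card_biUnion]
    · rw [Finset.sum_congr rfl fun p _ => hN p]; simp
    · intro p _ q _ hpq
      rw [Function.onFun, Finset.disjoint_left]
      intro σ h1 h2
      simp only [Finset.mem_filter, Finset.mem_univ, true_and] at h1 h2
      exact hpq (h1.unique h2)
  have htot : Fintype.card (Equiv.Perm (Fin G)) = m * N p₀ := by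
    have h := key Finset.univ
    rw [Finset.card_univ, Fintype.card_fin] at h
    rw [← h, ← Finset.card_univ]
    congr 1
    ext σ
    simpa using exists_isArgmin hm σ v
  rw [key, htot]; ring

/-- A `k`-uniform hypergraph with ordered edges that cannot be coloured with `r` colours, but
all of whose weighted vertex sets contain an independent set of relative weight at least `μ`; this
is witnessed by a family of transversals `B ω` covering each vertex with density at most
`1 - μ`. -/
theorem exists_fractional_hypergraph (k r : ℕ) (hk : 1 ≤ k) (hr : 1 ≤ r) (μ : ℝ)
    (hμ₁ : μ < ((k : ℝ) - 1) / (k : ℝ)) :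
    ∃ (V : Type) (_ : Fintype V) (E : Set (Fin k → V)) (Ω : Type) (_ : Fintype Ω) (_ : Nonempty Ω)
      (B : Ω → V → Prop), (∀ e ∈ E, Function.Injective e) ∧
      (∀ c : V → Fin r, ∃ e ∈ E, ∀ i j, c (e i) = c (e j)) ∧
      (∀ ω, ∀ e ∈ E, ∃ i, B ω (e i)) ∧
      ∀ v, μ * (Fintype.card Ω : ℝ) ≤ (Nat.card {ω // ¬ B ω v} : ℝ) := by
  classical
  have hk0 : (0 : ℝ) < k := by exact_mod_cast hk
  -- At most `M + 2 * k` of `k * M` positions will be selected, a density of at most `1/k + 2/M`;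
  -- this choice makes it less than `1 - μ`.
  obtain ⟨M, hM⟩ := exists_nat_gt (2 / (((k : ℝ) - 1) / k - μ))
  have hgap : 0 < ((k : ℝ) - 1) / k - μ := by linarith
  have hM0 : (0 : ℝ) < M := lt_trans (by positivity) hM
  have hMpos : 0 < M := by exact_mod_cast hM0
  have hmpos : 0 < k * M := Nat.mul_pos hk hMpos
  obtain ⟨m, hm⟩ : ∃ m, k * M = m + 1 := ⟨k * M - 1, by omega⟩
  obtain ⟨G, hG⟩ := exists_monochromatic_windows m (Fin r) (k - 1)
  -- The multiples of `k` catch the drifting minimum; the two margins of width `k` exclude windows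
  -- whose minimum is about to leave or has just entered.
  let S : Finset (Fin (m + 1)) := Finset.univ.filter fun p =>
    k ∣ (p : ℕ) ∨ (p : ℕ) < k ∨ m + 1 ≤ p + k
  have hS : S.card ≤ M + 2 * k := by
    have h1 : S.map Fin.valEmbedding ⊆ (Finset.range M).image (k * ·) ∪ Finset.range k ∪
        Finset.Ico (m + 1 - k) (m + 1) := by
      intro p hp
      simp only [S, Finset.mem_map, Finset.mem_filter, Finset.mem_univ, true_and,
        Fin.valEmbedding_apply] at hp
      obtain ⟨q, hq, rfl⟩ := hp
      simp only [Finset.mem_union, Finset.mem_image, Finset.mem_range, Finset.mem_Ico]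
      rcases hq with ⟨t, ht⟩ | hq | hq
      · refine Or.inl (Or.inl ⟨t, ?_, ht.symm⟩)
        have := q.isLt
        rw [ht, ← hm] at this
        exact Nat.lt_of_mul_lt_mul_left this
      · exact Or.inl (Or.inr hq)
      · exact Or.inr ⟨by omega, q.isLt⟩
    have h2 := Finset.card_le_card h1
    rw [Finset.card_map] at h2
    refine h2.trans ((Finset.card_union_le _ _).trans ?_)
    have h3 := Finset.card_union_le ((Finset.range M).image (k * ·)) (Finset.range k)
    have h4 := Finset.card_image_le (s := Finset.range M) (f := (k * ·))
    simp only [Finset.card_range, Nat.card_Ico] at h3 h4 ⊢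
    omega
  have hmono : ∀ (x : ℕ → ℕ) (n : ℕ), (∀ a, a + 1 < n → x a < x (a + 1)) →
      ∀ a b, a < b → b < n → x a < x b := by
    intro x n hx a b hab
    induction b, hab using Nat.le_induction with
    | base => exact hx a
    | succ b hab ih => exact fun hb => (ih (by omega)).trans (hx b hb)
  refine ⟨Fin (m + 1) ↪ Fin G, inferInstance,
    {e | ∃ x : ℕ → ℕ, (∀ a, a + 1 < m + k → x a < x (a + 1)) ∧
      ∀ j a, ((e j a : Fin G) : ℕ) = x (j + a)},
    Equiv.Perm (Fin G), inferInstance, inferInstance,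
    fun σ v => ∃ p ∈ S, IsArgmin σ v p, ?_, ?_, ?_, ?_⟩
  · rintro e ⟨x, hx, he⟩ i j hij
    have h1 : x i = x j := by
      have := he i 0
      rw [hij, he j 0] at this
      simpa using this.symm
    rcases lt_trichotomy (i : ℕ) j with h | h | h
    · have := hmono x _ hx i j h (by omega)
      omega
    · exact Fin.ext h
    · have := hmono x _ hx j i h (by omega)
      omega
  · intro c
    obtain ⟨z, hz1, hz2, i₀, hz3⟩ := hG fun t =>
      if h : ∃ v : Fin (m + 1) ↪ Fin G, ∀ a, ((v a : Fin G) : ℕ) = t a then c h.choose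
      else ⟨0, hr⟩
    have hzm := hmono z _ hz1
    let e : Fin k → Fin (m + 1) ↪ Fin G := fun j =>
      ⟨fun a => ⟨z (j + a), hz2 _ (by omega)⟩, by
        intro a b hab
        have h1 : z (j + a) = z (j + b) := congrArg Fin.val hab
        rcases lt_trichotomy (a : ℕ) b with h | h | h
        · have := hzm (j + a) (j + b) (by omega) (by omega)
          omega
        · exact Fin.ext h
        · have := hzm (j + b) (j + a) (by omega) (by omega)
          omega⟩
    have hc : ∀ j, c (e j) = i₀ := by
      intro j
      rw [← hz3 j (by omega)]
      have h : ∃ v : Fin (m + 1) ↪ Fin G, ∀ a : Fin (m + 1), ((v a : Fin G) : ℕ) = z (j + a) :=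
        ⟨e j, fun a => rfl⟩
      rw [dif_pos h]
      congr 1
      ext a
      exact (h.choose_spec a).symm
    exact ⟨e, ⟨z, fun a ha => hz1 a (by omega), fun j a => rfl⟩, fun i j => by rw [hc, hc]⟩
  · rintro σ e ⟨x, hx, he⟩
    by_contra! hno
    have hS' : ∀ j p, IsArgmin σ (e j) p → ¬ k ∣ (p : ℕ) ∧ k ≤ (p : ℕ) ∧ (p : ℕ) + k < m + 1 := by
      intro j p hp
      have : p ∉ S := fun h => hno j p h hp
      simpa [S, not_or] using this
    obtain ⟨p, hp⟩ := exists_isArgmin (Nat.succ_pos m) σ (e ⟨0, hk⟩)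
    have hp' := hS' _ _ hp
    -- Away from the margins, the old minimum survives the shift and the new one was already
    -- present, so both are the same element, one position further left.
    have shift : ∀ j (hj : j < k), IsArgmin σ (e ⟨j, hj⟩) ⟨p - j, by omega⟩ := by
      intro j
      induction j with
      | zero => exact fun _ => hp
      | succ j ih =>
        intro hj
        have ih := ih (by omega)
        obtain ⟨q, hq⟩ := exists_isArgmin (Nat.succ_pos m) σ (e ⟨j + 1, hj⟩)
        have hq' := hS' _ _ hq
        have e1 : e ⟨j + 1, hj⟩ q = e ⟨j, by omega⟩ ⟨q + 1, by omega⟩ := by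
          apply Fin.ext
          rw [he, he]
          congr 1
          simp only
          omega
        have e2 : e ⟨j, by omega⟩ ⟨p - j, by omega⟩ =
            e ⟨j + 1, hj⟩ ⟨p - (j + 1), by omega⟩ := by
          apply Fin.ext
          rw [he, he]
          congr 1
          simp only
          omega
        have h1 := hq ⟨p - (j + 1), by omega⟩
        have h2 := ih ⟨q + 1, by omega⟩
        rw [e2, ← e1] at h2
        have h3 := (e _).injective (σ.injective (le_antisymm h1 h2))
        rwa [h3] at hq
    have hlt : (p : ℕ) % k < k := Nat.mod_lt _ hk
    exact (hS' _ _ (shift (p % k) hlt)).1 (Nat.dvd_sub_mod _)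
  · intro v
    have h1 := card_mul_card_isArgmin_mem (Nat.succ_pos m) v S
    have h2 := Finset.card_filter_add_card_filter_not (s := (Finset.univ : Finset (Equiv.Perm (Fin G))))
      (fun σ => ∃ p ∈ S, IsArgmin σ v p)
    rw [Nat.card_eq_fintype_card, Fintype.card_subtype]
    rw [Finset.card_univ] at h2
    generalize (Finset.univ.filter fun σ : Equiv.Perm (Fin G) => ∃ p ∈ S, IsArgmin σ v p).card = A
      at h1 h2
    generalize (Finset.univ.filter fun σ : Equiv.Perm (Fin G) =>
      ¬ ∃ p ∈ S, IsArgmin σ v p).card = A' at h2 ⊢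
    generalize Fintype.card (Equiv.Perm (Fin G)) = W at h1 h2 ⊢
    have h1' : (k * M : ℝ) * A = S.card * W := by
      have : k * M * A = S.card * W := by rw [hm]; exact h1
      exact_mod_cast this
    have h2' : (A : ℝ) + A' = W := by exact_mod_cast h2
    have hS' : (S.card : ℝ) ≤ M + 2 * k := by exact_mod_cast hS
    have hgapM : 2 ≤ (((k : ℝ) - 1) / k - μ) * M := by
      rw [div_lt_iff₀ hgap] at hM
      linarith
    have h3 : μ * (k * M) ≤ k * M - (M + 2 * k) := by
      have := mul_le_mul_of_nonneg_left hgapM hk0.le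
      have h4 : (k : ℝ) * ((((k : ℝ) - 1) / k - μ) * M) = (k - 1) * M - μ * (k * M) := by
        field_simp
      linarith
    have hkM : (0 : ℝ) < k * M := by positivity
    have hW : (0 : ℝ) ≤ W := Nat.cast_nonneg _
    refine le_of_mul_le_mul_left ?_ hkM
    have h5 := mul_le_mul_of_nonneg_right hS' hW
    have h6 := mul_le_mul_of_nonneg_right h3 hW
    have h7 : (k * M : ℝ) * A' = k * M * W - S.card * W := by
      rw [← h1', ← h2']; ring
    rw [h7]
    nlinarith

/-! ### A sparse Hales-Jewett theorem. -/

/-- The extension of a line in one block `b` by constant values on the other blocks. -/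
def Combinatorics.Line.extendBlock {F B K : Type} [DecidableEq B] (b : B) (z : B → K → F)
    (l : Combinatorics.Line F K) : Combinatorics.Line F (B × K) where
  idxFun p := if p.1 = b then l.idxFun p.2 else some (z p.1 p.2)
  proper := by
    obtain ⟨κ, h⟩ := l.proper
    exact ⟨(b, κ), by simpa using h⟩

/-- If each of the points of `P` forbids, for each of few colourings, one value of a function
`P → T`, then some function violates a prohibition for every colouring. -/
theorem exists_choice_meeting {P T C : Type} [Fintype P] [Fintype T] [Fintype C]
    (τ : C → P → T)
    (h : Fintype.card C * (Fintype.card T - 1) ^ Fintype.card P <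
      Fintype.card T ^ Fintype.card P) :
    ∃ t : P → T, ∀ c, ∃ p, t p = τ c p := by
  classical
  by_contra! hno
  have hcov : (Finset.univ : Finset (P → T)) ⊆
      Finset.univ.biUnion fun c => Fintype.piFinset fun p => Finset.univ.erase (τ c p) := by
    intro t _
    obtain ⟨c, hc⟩ := hno t
    simpa using ⟨c, hc⟩
  have h1 := (Finset.card_le_card hcov).trans Finset.card_biUnion_le
  simp only [Finset.card_univ, Fintype.card_pi, Finset.prod_const, Fintype.card_piFinset,
    Finset.card_erase_of_mem (Finset.mem_univ _), Finset.sum_const, smul_eq_mul] at h1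
  omega

theorem exists_mul_pred_pow_lt_pow (A T : ℕ) (hT : 0 < T) :
    ∃ m, 0 < m ∧ A * (T - 1) ^ m < T ^ m := by
  have hT' : (0 : ℝ) < T := by exact_mod_cast hT
  have hlt : ((T - 1 : ℕ) : ℝ) / T < 1 := by
    rw [div_lt_one hT']
    exact_mod_cast Nat.sub_lt hT one_pos
  obtain ⟨n, hn⟩ := exists_pow_lt_of_lt_one (show (0 : ℝ) < 1 / (A + 1) by positivity) hlt
  have hpos : (0 : ℝ) ≤ ((T - 1 : ℕ) : ℝ) / T := by positivity
  have hn' : (((T - 1 : ℕ) : ℝ) / T) ^ (n + 1) < 1 / (A + 1) :=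
    lt_of_le_of_lt (pow_le_pow_of_le_one hpos hlt.le n.le_succ) hn
  refine ⟨n + 1, n.succ_pos, ?_⟩
  rw [div_pow, div_lt_div_iff₀ (by positivity) (by positivity)] at hn'
  have h : ((T - 1 : ℕ) : ℝ) ^ (n + 1) * (A + 1) < (T : ℝ) ^ (n + 1) := by linarith
  have h' : (T - 1) ^ (n + 1) * (A + 1) < T ^ (n + 1) := by exact_mod_cast h
  nlinarith [Nat.zero_le ((T - 1) ^ (n + 1))]

/-- A sparse Hales-Jewett theorem: the coordinates are partitioned into blocks, the lines under
consideration move within a single block, and the block together with the constants outside of it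
determines the line. -/
theorem exists_sparse_lines (F : Type) [Fintype F] [Nonempty F] (r : ℕ) :
    ∃ (B K : Type) (_ : Fintype B) (_ : Fintype K) (𝓛 : Set (Combinatorics.Line F (B × K))),
      (∀ l ∈ 𝓛, ∃ b, ∀ p, l.idxFun p = none → p.1 = b) ∧
      (∀ l ∈ 𝓛, ∀ l' ∈ 𝓛, ∀ b, (∀ p : B × K, p.1 ≠ b → l.idxFun p ≠ none ∧
        l.idxFun p = l'.idxFun p) → l = l') ∧
      ∀ C : (B × K → F) → Fin r, ∃ l ∈ 𝓛, l.IsMono C := by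
  classical
  obtain ⟨K, _, hK⟩ := Combinatorics.Line.exists_mono_in_high_dimension F (Fin r)
  have : Finite (Combinatorics.Line F K) :=
    Finite.of_injective (fun l => l.idxFun) fun l l' h => Combinatorics.Line.ext h
  have := Fintype.ofFinite (Combinatorics.Line F K)
  by_cases hr : r = 0
  · subst hr
    exact ⟨Unit, K, inferInstance, inferInstance, ∅, by simp, by simp,
      fun C => (C fun _ => Classical.arbitrary F).elim0⟩
  have hr' : 0 < r := Nat.pos_of_ne_zero hr
  have hT : 0 < Fintype.card (Combinatorics.Line F K) :=
    Fintype.card_pos_iff.2 ⟨(hK fun _ => ⟨0, hr'⟩).choose⟩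
  obtain ⟨n, hn0, hn⟩ := exists_mul_pred_pow_lt_pow (r ^ Fintype.card (K → F)) _ hT
  -- One line will be kept for each block and each choice of constants outside it. With `N =
  -- |F|^|K|` there are `r^(N^n)` colourings and `n * N^(n-1)` such pairs, so the counting condition
  -- is the `N^(n-1)`-th power of the inequality defining `n`.
  let P := Σ b : Fin n, ({b' // b' ≠ b} → K → F)
  -- The default value on the block `p.1` is never read by `extendBlock`.
  let ext : P → Fin n → K → F := fun p b =>
    if h : b ≠ p.1 then p.2 ⟨b, h⟩ else fun _ => Classical.arbitrary F
  have hτ : ∀ (C : (Fin n × K → F) → Fin r) (p : P), ∃ l : Combinatorics.Line F K,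
      (l.extendBlock p.1 (ext p)).IsMono C := by
    intro C p
    obtain ⟨l, c, hl⟩ := hK fun y => C fun q => if q.1 = p.1 then y q.2 else ext p q.1 q.2
    refine ⟨l, c, fun x => ?_⟩
    rw [← hl x]
    congr 1
    funext q
    by_cases hq : q.1 = p.1 <;> simp [Combinatorics.Line.extendBlock, hq]
  choose τ hτ using hτ
  have hcard : Fintype.card ((Fin n × K → F) → Fin r) *
      (Fintype.card (Combinatorics.Line F K) - 1) ^ Fintype.card P <
        Fintype.card (Combinatorics.Line F K) ^ Fintype.card P := by
    have hP : Fintype.card P = n * Fintype.card (K → F) ^ (n - 1) := by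
      simp [P, Fintype.card_sigma, Fintype.card_subtype_compl]
    have hC : Fintype.card ((Fin n × K → F) → Fin r) =
        (r ^ Fintype.card (K → F)) ^ (Fintype.card (K → F) ^ (n - 1)) := by
      have h1 : Fintype.card (Fin n × K → F) = Fintype.card (K → F) ^ n := by
        rw [Fintype.card_congr (Equiv.curry (Fin n) K F), Fintype.card_fun, Fintype.card_fin]
      rw [Fintype.card_fun, Fintype.card_fin, h1, ← pow_mul, ← pow_succ', Nat.sub_add_cancel hn0]
    rw [hP, hC, pow_mul, pow_mul, ← mul_pow]
    exact Nat.pow_lt_pow_left hn (pow_pos Fintype.card_pos _).ne'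
  obtain ⟨t, ht⟩ := exists_choice_meeting τ hcard
  refine ⟨Fin n, K, inferInstance, inferInstance,
    Set.range fun p : P => (t p).extendBlock p.1 (ext p), ?_, ?_, ?_⟩
  · rintro _ ⟨p, rfl⟩
    refine ⟨p.1, fun q hq => ?_⟩
    by_contra hne
    simp [Combinatorics.Line.extendBlock, hne] at hq
  · rintro _ ⟨p, rfl⟩ _ ⟨p', rfl⟩ b hb
    have hpb : p.1 = b := by
      by_contra hne
      obtain ⟨κ, hκ⟩ := (t p).proper
      exact (hb (p.1, κ) hne).1 (by simpa [Combinatorics.Line.extendBlock] using hκ)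
    have hpb' : p'.1 = b := by
      by_contra hne
      obtain ⟨κ, hκ⟩ := (t p').proper
      have := hb (p'.1, κ) hne
      exact this.1 (this.2.trans (by simpa [Combinatorics.Line.extendBlock] using hκ))
    obtain ⟨b₁, z⟩ := p
    obtain ⟨b₂, z'⟩ := p'
    obtain rfl : b₁ = b := hpb
    obtain rfl : b₂ = b₁ := hpb'
    suffices z = z' by rw [this]
    funext b' κ
    have := (hb (b', κ) b'.2).2
    simpa [Combinatorics.Line.extendBlock, ext, b'.2] using this
  · intro C
    obtain ⟨p, hp⟩ := ht C
    exact ⟨_, ⟨p, rfl⟩, by simpa only [hp] using hτ C p⟩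

/-! ### Quasilines and the partite construction. -/

section

open Function

/-- A parametrised quasiline: `k` distinct points each of whose coordinates is either constant or
injective. -/
def IsQuasilineMap {k : ℕ} {ι : Type} (y : Fin k → ι → Fin k) : Prop :=
  Injective y ∧ ∀ ν, (∀ i j, y i ν = y j ν) ∨ Injective fun i => y i ν

theorem const_or_isQuasilineMap {k : ℕ} {ι : Type} {y : Fin k → ι → Fin k}
    (hy : ∀ ν, (∀ i j, y i ν = y j ν) ∨ Injective fun i => y i ν) :
    (∀ i j, y i = y j) ∨ IsQuasilineMap y := by
  by_cases h : ∃ ν, Injective fun i => y i ν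
  · obtain ⟨ν, hν⟩ := h
    exact Or.inr ⟨fun i j hij => hν (congrFun hij ν), hy⟩
  · push Not at h
    exact Or.inl fun i j => funext fun ν => ((hy ν).resolve_right (h ν)) i j

theorem exists_ne_ne {k : ℕ} (hk : 3 ≤ k) (a b : Fin k) : ∃ c, c ≠ a ∧ c ≠ b := by
  obtain ⟨c, hc⟩ : (({a, b} : Finset (Fin k))ᶜ).Nonempty := by
    rw [← Finset.card_pos, Finset.card_compl, Fintype.card_fin]
    have := Finset.card_le_two (a := a) (b := b)
    omega
  exact ⟨c, by simpa [not_or] using hc⟩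

/-- A quasiline is determined by all but one of its points. -/
theorem IsQuasilineMap.eq_of_eq_off {k : ℕ} (hk : 3 ≤ k) {ι : Type} {y z : Fin k → ι → Fin k}
    (hy : IsQuasilineMap y) (hz : IsQuasilineMap z) (i₀ : Fin k) (h : ∀ i ≠ i₀, y i = z i) :
    y = z := by
  obtain ⟨a, ha, -⟩ := exists_ne_ne hk i₀ i₀
  obtain ⟨b, hb, hba⟩ := exists_ne_ne hk i₀ a
  funext i ν
  by_cases hi : i = i₀
  swap
  · rw [h i hi]
  subst hi
  rcases hy.2 ν with hyν | hyν <;> rcases hz.2 ν with hzν | hzν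
  · rw [hyν i a, hzν i a, h a ha]
  · exact absurd (hzν (by simpa [h a ha, h b hb] using hyν b a)) hba
  · exact absurd (hyν (by simpa [h a ha, h b hb] using hzν b a)) hba
  -- An injective coordinate takes all `k` values, so the omitted point gets the one left over.
  · obtain ⟨j, hj⟩ := (Finite.injective_iff_surjective.1 hyν) (z i ν)
    by_cases hji : j = i
    · subst hji; exact hj
    · simp only [h j hji] at hj
      exact absurd (hzν hj) hji

namespace Combinatorics.Line

variable {A ι J : Type} {F : Set (ι → A)}

/-- Substitution of a point `x` for the moving coordinates of a line over the alphabet `F`, where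
`F` consists of points of a cube. -/
def substitute (l : Line F J) (x : ι → A) : J × ι → A := fun p =>
  ((l.idxFun p.1).elim x Subtype.val) p.2

/-- Substitution of a line for the moving coordinates of a line over an alphabet consisting of
points of a cube. -/
def comp (l : Line F J) (m : Line A ι) : Line A (J × ι) where
  idxFun p := (l.idxFun p.1).elim (m.idxFun p.2) fun f => some (f.1 p.2)
  proper := by
    obtain ⟨j, hj⟩ := l.proper
    obtain ⟨ν, hν⟩ := m.proper
    exact ⟨(j, ν), by simp [hj, hν]⟩

theorem comp_apply (l : Line F J) (m : Line A ι) (a : A) : l.comp m a = l.substitute (m a) := by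
  funext p
  cases h : l.idxFun p.1 <;> simp [comp, substitute, h]

theorem substitute_coe (l : Line F J) (x : F) :
    l.substitute x.1 = fun p => (l x p.1).1 p.2 := by
  funext p
  cases h : l.idxFun p.1 <;> simp [substitute, h]

theorem substitute_block (l : Line F J) (x : ι → A) (j : J) :
    (fun ν => l.substitute x (j, ν)) = (l.idxFun j).elim x Subtype.val := rfl

end Combinatorics.Line

open Combinatorics

variable {k : ℕ} {V ι : Type}

/-- `X` is a set of points labelled by vertices of the ordered hypergraph `E` such that every
quasiline in `X` is a combinatorial line labelled by an edge. -/
def IsPicture (E : Set (Fin k → V)) (X : Set (ι → Fin k)) (π : (ι → Fin k) → V) : Prop :=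
  ∀ y : Fin k → ι → Fin k, IsQuasilineMap y → (∀ i, y i ∈ X) →
    ∃ (m : Line (Fin k) ι), ∃ e ∈ E, ∃ σ : Equiv.Perm (Fin k),
      ∀ i, y i = m (σ i) ∧ π (y i) = e (σ i)

/-- Every colouring of `X` that depends only on the label outside of the labels in `S` has a
monochromatic line. -/
def IsLineRamsey (r : ℕ) (S : Set V) (X : Set (ι → Fin k)) (π : (ι → Fin k) → V) : Prop :=
  ∀ C : (ι → Fin k) → Fin r,
    (∀ x ∈ X, ∀ x' ∈ X, π x = π x' → π x ∉ S → C x = C x') →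
      ∃ m : Line (Fin k) ι, (∀ a, m a ∈ X) ∧ ∀ a b, C (m a) = C (m b)

/-- The coordinates `(e, true)` tell the lines apart. They take only two values, so a quasiline,
having at least three points, is constant there and stays within a single line. A colouring that
factors through the labels is a colouring of `V`, whence the Ramsey property. -/
theorem exists_initial_picture [Finite V] {r : ℕ} (hk : 3 ≤ k) (hr : 1 ≤ r)
    (E : Set (Fin k → V)) (hE : ∀ c : V → Fin r, ∃ e ∈ E, ∀ i j, c (e i) = c (e j)) :
    ∃ (ι : Type) (_ : Fintype ι) (X : Set (ι → Fin k)) (π : (ι → Fin k) → V),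
      IsPicture E X π ∧ IsLineRamsey r ∅ X π := by
  classical
  have := Fintype.ofFinite E
  let o : Fin k := ⟨0, by omega⟩
  let u : Fin k := ⟨1, by omega⟩
  have huo : u ≠ o := by simp [u, o]
  have hV : Nonempty V := by
    obtain ⟨e, -⟩ := hE fun _ => ⟨0, hr⟩
    exact ⟨e o⟩
  let m : E → Line (Fin k) (E × Bool) := fun e =>
    { idxFun := fun p => if p.1 = e then (if p.2 then some u else none) else some o
      proper := ⟨(e, false), by simp⟩ }
  have hm1 : ∀ e e' a, m e a (e', true) = if e' = e then u else o := by
    intro e e' a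
    by_cases h : e' = e <;> simp [m, h]
  have hm2 : ∀ e a, m e a (e, false) = a := by
    intro e a
    simp [m]
  let U : E × Fin k → E × Bool → Fin k := fun p => m p.1 p.2
  have hU : Injective U := by
    rintro ⟨e, a⟩ ⟨e', a'⟩ h
    have h1 := congrFun h (e, true)
    simp only [U, hm1, if_true] at h1
    have he : e = e' := by
      by_contra hne
      rw [if_neg hne] at h1
      exact huo h1
    subst he
    have h2 := congrFun h (e, false)
    simp only [U, hm2] at h2
    rw [h2]
  let π : (E × Bool → Fin k) → V := Function.extend U (fun p => p.1.1 p.2)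
    fun _ => Classical.arbitrary V
  have hπ : ∀ e a, π (m e a) = e.1 a := fun e a => hU.extend_apply _ _ (e, a)
  refine ⟨E × Bool, inferInstance, Set.range U, π, ?_, ?_⟩
  · intro y hy hyX
    choose p hp using hyX
    have hconst : ∀ i j, (p i).1 = (p j).1 := by
      intro i j
      have hval : ∀ i', y i' ((p j).1, true) = u ∨ y i' ((p j).1, true) = o := by
        intro i'
        rw [← hp]
        simp only [U, hm1]
        split_ifs <;> simp
      have hj : y j ((p j).1, true) = u := by
        rw [← hp]
        exact (hm1 _ _ _).trans (if_pos rfl)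
      rcases hy.2 ((p j).1, true) with h | h
      · have hi := (h i j).trans hj
        rw [← hp] at hi
        simp only [U, hm1] at hi
        by_contra hne
        rw [if_neg (Ne.symm hne)] at hi
        exact huo hi.symm
      · obtain ⟨a, ha, -⟩ := exists_ne_ne hk j j
        obtain ⟨b, hb, hba⟩ := exists_ne_ne hk j a
        have ha' := (hval a).resolve_left fun h' => ha (h (h'.trans hj.symm))
        have hb' := (hval b).resolve_left fun h' => hb (h (h'.trans hj.symm))
        exact absurd (h (hb'.trans ha'.symm)) hba
    let e := (p o).1
    have hpe : ∀ i, y i = m e (p i).2 := by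
      intro i
      rw [← hp]
      simp only [U, e, hconst i o]
    have hinj : Injective fun i => (p i).2 := by
      intro i j h
      apply hy.1
      rw [hpe, hpe]
      exact congrArg _ h
    refine ⟨m e, e.1, e.2, Equiv.ofBijective _ (Finite.injective_iff_bijective.1 hinj), fun i => ?_⟩
    rw [Equiv.ofBijective_apply, ← hπ, ← hpe]
    exact ⟨rfl, rfl⟩
  · intro C hC
    let c : V → Fin r := fun v =>
      if h : ∃ x ∈ Set.range U, π x = v then C h.choose else ⟨0, hr⟩
    have hc : ∀ x ∈ Set.range U, c (π x) = C x := by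
      intro x hx
      have h : ∃ x' ∈ Set.range U, π x' = π x := ⟨x, hx, rfl⟩
      simp only [c, dif_pos h]
      exact hC _ h.choose_spec.1 _ hx h.choose_spec.2 (by simp)
    obtain ⟨e, he, hmono⟩ := hE c
    refine ⟨m ⟨e, he⟩, fun a => ⟨(⟨e, he⟩, a), rfl⟩, fun a b => ?_⟩
    rw [← hc _ ⟨(⟨e, he⟩, a), rfl⟩, ← hc _ ⟨(⟨e, he⟩, b), rfl⟩, hπ, hπ]
    exact hmono a b

/-- Over the alphabet `F` of points labelled `v`, a monochromatic line of the sparse family yields a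
copy of `X` in which the colour is constant on label `v`, so the Ramsey property for `S` applies to
that copy. -/
theorem exists_amalgamation [Fintype ι] {r : ℕ} (hk : 3 ≤ k) {E : Set (Fin k → V)}
    (hE : ∀ e ∈ E, Injective e) {X : Set (ι → Fin k)} {π : (ι → Fin k) → V}
    (hX : IsPicture E X π) {S : Set V} (hS : IsLineRamsey r S X π) (v : V) :
    ∃ (ι' : Type) (_ : Fintype ι') (X' : Set (ι' → Fin k)) (π' : (ι' → Fin k) → V),
      IsPicture E X' π' ∧ IsLineRamsey r (insert v S) X' π' := by
  classical
  let F : Set (ι → Fin k) := {x | x ∈ X ∧ π x = v}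
  by_cases hF : IsEmpty F
  · refine ⟨ι, inferInstance, X, π, hX, fun C hC => hS C fun x hx x' hx' h hxS => ?_⟩
    refine hC x hx x' hx' h ?_
    rintro (hv | hv)
    · exact hF.false ⟨x, hx, hv⟩
    · exact hxS hv
  rw [not_isEmpty_iff] at hF
  obtain ⟨B, K, _, _, 𝓛, h𝓛₁, h𝓛₂, h𝓛₃⟩ := exists_sparse_lines F r
  let blk : (B × K) → ((B × K) × ι → Fin k) → ι → Fin k := fun j y ν => y (j, ν)
  let X' : Set ((B × K) × ι → Fin k) := {y | ∃ l ∈ 𝓛, ∃ x ∈ X, y = l.substitute x}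
  -- Any component outside `F` is the substituted point itself, so the label does not depend on the
  -- chosen component.
  let π' : ((B × K) × ι → Fin k) → V := fun y =>
    if h : ∃ j, blk j y ∉ F then π (blk h.choose y) else v
  have hblk : ∀ (l : Line F (B × K)) x j, blk j (l.substitute x) ∉ F →
      l.idxFun j = none ∧ blk j (l.substitute x) = x := by
    intro l x j h
    simp only [blk, l.substitute_block] at h ⊢
    cases hj : l.idxFun j with
    | none => simp
    | some f => simp [hj] at h
  have hblk_some : ∀ (l : Line F (B × K)) x j, blk j (l.substitute x) ∈ F → x ∉ F →
      ∃ f, l.idxFun j = some f ∧ blk j (l.substitute x) = f.1 := by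
    intro l x j h hx
    simp only [blk, l.substitute_block] at h ⊢
    cases hj : l.idxFun j with
    | none => exact absurd (by simpa [hj] using h) hx
    | some f => exact ⟨f, rfl, rfl⟩
  have hπ' : ∀ (l : Line F (B × K)), ∀ x ∈ X, π' (l.substitute x) = π x := by
    intro l x hx
    by_cases h : ∃ j, blk j (l.substitute x) ∉ F
    · simp only [π', dif_pos h, (hblk l x _ h.choose_spec).2]
    · simp only [π', dif_neg h]
      push Not at h
      obtain ⟨j, hj⟩ := l.proper
      have := h j
      simp only [blk, l.substitute_block, hj, Option.elim_none] at this
      exact this.2.symm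
  refine ⟨(B × K) × ι, inferInstance, X', π', ?_, ?_⟩
  · intro y hy hyX
    choose l hl x hx hyl using hyX
    have hX_blk : ∀ i j, blk j (y i) ∈ X := by
      intro i j
      rw [hyl]
      simp only [blk, (l i).substitute_block]
      cases (l i).idxFun j with
      | none => exact hx i
      | some f => exact f.2.1
    have hdich : ∀ j, (∀ i i', blk j (y i) = blk j (y i')) ∨
        IsQuasilineMap fun i => blk j (y i) := fun j =>
      const_or_isQuasilineMap fun ν => hy.2 (j, ν)
    have hF_unique : ∀ j, (IsQuasilineMap fun i => blk j (y i)) → ∀ i i', blk j (y i) ∈ F →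
        blk j (y i') ∈ F → i = i' := by
      intro j hj i i' hi hi'
      obtain ⟨m, e, he, σ, h⟩ := hX _ hj fun i => hX_blk i j
      have h1 : e (σ i) = e (σ i') := by rw [← (h i).2, ← (h i').2, hi.2, hi'.2]
      exact σ.injective (hE e he h1)
    have hnon : ∀ i j, blk j (y i) ∉ F → (l i).idxFun j = none ∧ blk j (y i) = x i := by
      intro i j h
      rw [hyl] at h ⊢
      exact hblk _ _ _ h
    have hsome : ∀ i j, blk j (y i) ∈ F → x i ∉ F →
        ∃ f, (l i).idxFun j = some f ∧ blk j (y i) = f.1 := by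
      intro i j h hxi
      rw [hyl] at h ⊢
      exact hblk_some _ _ _ h hxi
    let o : Fin k := ⟨0, by omega⟩
    obtain ⟨j₀, hj₀⟩ : ∃ j, IsQuasilineMap fun i => blk j (y i) := by
      by_contra! hno
      obtain ⟨a, ha, -⟩ := exists_ne_ne hk o o
      refine ha (hy.1 (funext fun p => ?_))
      exact congrFun (((hdich p.1).resolve_right (hno p.1)) a o) p.2
    -- A constant component outside `F` would force all `x i` to coincide, but in `j₀` at least two
    -- of the points lie outside `F` and exhibit distinct `x i`.
    have hconst : ∀ i j, blk j (y i) ∉ F → IsQuasilineMap fun i => blk j (y i) := by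
      intro i j hij
      refine (hdich j).resolve_left fun hc => ?_
      obtain ⟨a, b, hab, ha, hb⟩ : ∃ a b, a ≠ b ∧ blk j₀ (y a) ∉ F ∧ blk j₀ (y b) ∉ F := by
        by_cases h : ∃ i₀, blk j₀ (y i₀) ∈ F
        · obtain ⟨i₀, hi₀⟩ := h
          obtain ⟨a, ha, -⟩ := exists_ne_ne hk i₀ i₀
          obtain ⟨b, hb, hba⟩ := exists_ne_ne hk i₀ a
          exact ⟨a, b, hba.symm, fun h => ha (hF_unique j₀ hj₀ _ _ h hi₀),
            fun h => hb (hF_unique j₀ hj₀ _ _ h hi₀)⟩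
        · push Not at h
          obtain ⟨a, ha, -⟩ := exists_ne_ne hk o o
          exact ⟨a, o, ha, h a, h o⟩
      have haj : blk j (y a) ∉ F := by rwa [hc a i]
      have hbj : blk j (y b) ∉ F := by rwa [hc b i]
      have h1 : blk j₀ (y a) = blk j₀ (y b) := by
        rw [(hnon a j₀ ha).2, (hnon b j₀ hb).2, ← (hnon a j haj).2, ← (hnon b j hbj).2, hc a b]
      exact hab (hj₀.1 h1)
    have hxF : ∀ i j, blk j (y i) ∉ F → x i ∉ F := by
      intro i j h
      rwa [← (hnon i j h).2]
    -- This is where sparsity enters. A third point `c` moves in both `j₁` and `j₂`, so `l a` and `l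
    -- b` move in one common block. Outside it their components lie in `F`, hence are constant along
    -- `y`, so `l a = l b`; yet only `l b` moves at `j₁`.
    have hkey : ∀ a b, a ≠ b → ∀ j₁ j₂, (IsQuasilineMap fun i => blk j₁ (y i)) →
        (IsQuasilineMap fun i => blk j₂ (y i)) → blk j₁ (y a) ∈ F → blk j₂ (y b) ∉ F := by
      intro a b hab j₁ j₂ h₁ h₂ ha hb
      obtain ⟨c, hca, hcb⟩ := exists_ne_ne hk a b
      have hb₁ : blk j₁ (y b) ∉ F := fun h => hab (hF_unique j₁ h₁ _ _ ha h)
      have hc₁ : blk j₁ (y c) ∉ F := fun h => hca (hF_unique j₁ h₁ _ _ h ha)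
      have ha₂ : blk j₂ (y a) ∉ F := fun h => hab (hF_unique j₂ h₂ _ _ h hb)
      have hc₂ : blk j₂ (y c) ∉ F := fun h => hcb (hF_unique j₂ h₂ _ _ h hb)
      obtain ⟨β, hβ⟩ := h𝓛₁ _ (hl c)
      obtain ⟨βa, hβa⟩ := h𝓛₁ _ (hl a)
      obtain ⟨βb, hβb⟩ := h𝓛₁ _ (hl b)
      have e₁ : j₁.1 = β := hβ _ (hnon _ _ hc₁).1
      have e₂ : j₂.1 = β := hβ _ (hnon _ _ hc₂).1
      have eb : βb = β := (hβb _ (hnon _ _ hb₁).1).symm.trans e₁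
      have ea : βa = β := (hβa _ (hnon _ _ ha₂).1).symm.trans e₂
      have hla : l a = l b := by
        refine h𝓛₂ _ (hl a) _ (hl b) β fun p hp => ?_
        have hpa : blk p (y a) ∈ F := by
          by_contra h
          exact hp ((hβa _ (hnon _ _ h).1).trans ea)
        have hpb : blk p (y b) ∈ F := by
          by_contra h
          exact hp ((hβb _ (hnon _ _ h).1).trans eb)
        obtain ⟨f, hf, hf'⟩ := hsome a p hpa (hxF _ _ ha₂)
        obtain ⟨g, hg, hg'⟩ := hsome b p hpb (hxF _ _ hb₁)
        have hpc : ∀ i i', blk p (y i) = blk p (y i') :=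
          (hdich p).resolve_right fun h => hab (hF_unique p h _ _ hpa hpb)
        have hfg : f = g := Subtype.ext (by rw [← hf', ← hg', hpc a b])
        rw [hf, hg, hfg]
        simp
      obtain ⟨f, hf, -⟩ := hsome a j₁ ha (hxF _ _ ha₂)
      rw [hla, (hnon _ _ hb₁).1] at hf
      simp at hf
    obtain ⟨i₀, hi₀⟩ : ∃ i₀, ∀ i ≠ i₀, ∀ j, (IsQuasilineMap fun i => blk j (y i)) →
        blk j (y i) ∉ F := by
      by_cases h : ∃ i j, (IsQuasilineMap fun i => blk j (y i)) ∧ blk j (y i) ∈ F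
      · obtain ⟨i₀, j₁, hj₁, hi₀⟩ := h
        exact ⟨i₀, fun i hi j hj => hkey i₀ i hi.symm j₁ j hj₁ hj hi₀⟩
      · push Not at h
        exact ⟨o, fun i _ j hj => h i j hj⟩
    obtain ⟨a, ha, -⟩ := exists_ne_ne hk i₀ i₀
    -- Off `i₀` every nonconstant component shows `x i`, and a quasiline is determined by all but
    -- one point. Hence `y` lies in the single copy given by `l a`.
    have hw : ∀ j, (IsQuasilineMap fun i => blk j (y i)) → ∀ i, blk j (y i) = blk j₀ (y i) := by
      intro j hj i
      refine congrFun (hj.eq_of_eq_off hk hj₀ i₀ fun i hi => ?_) i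
      rw [(hnon _ _ (hi₀ i hi j hj)).2, (hnon _ _ (hi₀ i hi j₀ hj₀)).2]
    have hy_eq : ∀ i, y i = (l a).substitute (blk j₀ (y i)) := by
      intro i
      funext ⟨j, ν⟩
      by_cases hj : IsQuasilineMap fun i => blk j (y i)
      · simp only [Line.substitute, (hnon _ _ (hi₀ a ha j hj)).1, Option.elim_none]
        exact congrFun (hw j hj i) ν
      · have hjF : blk j (y a) ∈ F := by
          by_contra h
          exact hj (hconst _ _ h)
        obtain ⟨f, hf, hf'⟩ := hsome a j hjF (hxF _ _ (hi₀ a ha j₀ hj₀))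
        simp only [Line.substitute, hf, Option.elim_some]
        rw [← hf']
        exact congrFun ((hdich j).resolve_right hj i a) ν
    obtain ⟨m, e, he, σ, h⟩ := hX _ hj₀ fun i => hX_blk i j₀
    refine ⟨(l a).comp m, e, he, σ, fun i => ⟨?_, ?_⟩⟩
    · rw [Line.comp_apply, ← (h i).1]
      exact hy_eq i
    · rw [hy_eq i, hπ' _ _ (hX_blk i j₀)]
      exact (h i).2
  · intro C hC
    obtain ⟨l, hl, c, hc⟩ := h𝓛₃ fun z => C fun p => (z p.1).1 p.2
    obtain ⟨m, hm, hmono⟩ := hS (fun x => C (l.substitute x)) (by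
      intro x hx x' hx' h hxS
      by_cases hv : π x = v
      · have h1 := hc ⟨x, hx, hv⟩
        have h2 := hc ⟨x', hx', h ▸ hv⟩
        simp only [← l.substitute_coe] at h1 h2
        exact h1.trans h2.symm
      · refine hC _ ⟨l, hl, x, hx, rfl⟩ _ ⟨l, hl, x', hx', rfl⟩ ?_ ?_
        · rw [hπ' l x hx, hπ' l x' hx', h]
        · rw [hπ' l x hx]
          rintro (h' | h')
          exacts [hv h', hxS h'])
    refine ⟨l.comp m, fun a => ⟨l, hl, m a, hm a, l.comp_apply m a⟩, fun a b => ?_⟩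
    rw [Line.comp_apply, Line.comp_apply]
    exact hmono a b

/-- The partite construction for quasilines. -/
theorem exists_ramsey_picture [Fintype V] {r : ℕ} (hk : 3 ≤ k) (hr : 1 ≤ r)
    (E : Set (Fin k → V)) (hE : ∀ e ∈ E, Injective e)
    (hχ : ∀ c : V → Fin r, ∃ e ∈ E, ∀ i j, c (e i) = c (e j)) :
    ∃ (ι : Type) (_ : Fintype ι) (X : Set (ι → Fin k)) (π : (ι → Fin k) → V),
      IsPicture E X π ∧ IsLineRamsey r Set.univ X π := by
  classical
  suffices ∀ S : Finset V, ∃ (ι : Type) (_ : Fintype ι) (X : Set (ι → Fin k))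
      (π : (ι → Fin k) → V), IsPicture E X π ∧ IsLineRamsey r (S : Set V) X π by
    simpa using this Finset.univ
  intro S
  induction S using Finset.induction_on with
  | empty => simpa using exists_initial_picture hk hr E hχ
  | insert v S _ ih =>
    obtain ⟨ι, _, X, π, h1, h2⟩ := ih
    simpa using exists_amalgamation hk hE h1 h2 v

/-! ### Averaging over transversals and transfer to `[k]^n`. -/

/-- If each vertex is missed by a proportion at least `μ` of the sets `B ω`, then some `B ω` misses
a proportion at least `μ` of the points of `Y`. -/
theorem exists_mul_card_le_card_filter {α Ω : Type} [Fintype Ω] [Nonempty Ω] (B : Ω → α → Prop)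
    [∀ ω, DecidablePred (B ω)] (Y : Finset α) {μ : ℝ}
    (h : ∀ x ∈ Y, μ * (Fintype.card Ω : ℝ) ≤ (Nat.card {ω // ¬ B ω x} : ℝ)) :
    ∃ ω, μ * (Y.card : ℝ) ≤ ((Y.filter fun x => ¬ B ω x).card : ℝ) := by
  classical
  by_contra! hlt
  have h1 : ∑ ω : Ω, ((Y.filter fun x => ¬ B ω x).card : ℝ) < ∑ _ω : Ω, μ * (Y.card : ℝ) :=
    Finset.sum_lt_sum_of_nonempty Finset.univ_nonempty fun ω _ => hlt ω
  have h2 : ∑ ω : Ω, ((Y.filter fun x => ¬ B ω x).card : ℝ) =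
      ∑ x ∈ Y, (Nat.card {ω // ¬ B ω x} : ℝ) := by
    simp only [Nat.card_eq_fintype_card, Fintype.card_subtype, Finset.card_filter, Nat.cast_sum]
    exact Finset.sum_comm
  have h3 := Finset.sum_le_sum h
  rw [h2] at h1
  simp only [Finset.sum_const, Finset.card_univ, nsmul_eq_mul] at h1 h3
  linarith

/-- A quasiline is the image of a parametrised quasiline. -/
theorem IsQuasiline.exists_isQuasilineMap {k n : ℕ} {ι : Type} (ε : ι ≃ Fin n)
    {L : Finset (Fin n → Fin k)} (hL : IsQuasiline L) :
    ∃ y : Fin k → Fin n → Fin k, Set.range y = L ∧ IsQuasilineMap fun i => y i ∘ ε := by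
  let q := L.equivFinOfCardEq hL.1
  have hq : Injective fun i => (q.symm i).1 := Subtype.val_injective.comp q.symm.injective
  refine ⟨fun i => (q.symm i).1, ?_, fun i j hij => hq (ε.surjective.injective_comp_right hij),
    fun ν => (hL.2 (ε ν)).imp (fun h i j => h _ (q.symm i).2 _ (q.symm j).2) fun h i j hij => ?_⟩
  · ext x
    refine ⟨?_, fun hx => ⟨q ⟨x, hx⟩, by simp⟩⟩
    rintro ⟨i, rfl⟩
    exact (q.symm i).2
  · by_contra hne
    exact h _ (q.symm i).2 _ (q.symm j).2 (hq.ne hne) hij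

theorem isCombinatorialLine_of_range_eq {k n : ℕ} {ι : Type} (ε : ι ≃ Fin n) (m : Line (Fin k) ι)
    {L : Finset (Fin n → Fin k)} (hL : (L : Set (Fin n → Fin k)) = Set.range fun a => m a ∘ ε.symm) :
    IsCombinatorialLine L := by
  obtain ⟨ν, hν⟩ := m.proper
  exact ⟨⟨m.idxFun ∘ ε.symm, ε ν, by simpa using hν⟩, hL⟩

end

theorem theorem1p7 (k r : ℕ) (hk : 3 ≤ k) (hr : 1 ≤ r) (μ : ℝ) (hμ₀ : 0 < μ)
    (hμ₁ : μ < ((k : ℝ) - 1) / (k : ℝ)) :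
    ∃ (n : ℕ) (X : Finset (Fin n → Fin k)), 1 ≤ n ∧
      (∀ γ : {x // x ∈ X} → Fin r,
        ∃ (L : Finset (Fin n → Fin k)) (hL : L ⊆ X), IsCombinatorialLine L ∧
          ∃ ρ : Fin r, ∀ (x : Fin n → Fin k) (hx : x ∈ L), γ ⟨x, hL hx⟩ = ρ) ∧
      (∀ Y : Finset (Fin n → Fin k), Y ⊆ X →
        ∃ Z : Finset (Fin n → Fin k), Z ⊆ Y ∧ μ * (Y.card : ℝ) ≤ (Z.card : ℝ) ∧
          ∀ L : Finset (Fin n → Fin k), L ⊆ Z → ¬ IsQuasiline L) ∧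
      (∀ L : Finset (Fin n → Fin k), L ⊆ X → IsQuasiline L → IsCombinatorialLine L) := by
  classical
  obtain ⟨V, _, E, Ω, _, _, B, hE, hχ, hB, hμ⟩ :=
    exists_fractional_hypergraph k r (by omega) hr μ hμ₁
  obtain ⟨ι, _, X, π, hX, hR⟩ := exists_ramsey_picture hk hr E hE hχ
  let ε : ι ≃ Fin (Fintype.card ι) := Fintype.equivFin ι
  let X' : Finset (Fin (Fintype.card ι) → Fin k) := Finset.univ.filter fun x => x ∘ ε ∈ X
  have hX' : ∀ x, x ∈ X' ↔ x ∘ ε ∈ X := by simp [X']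
  have hcomp : ∀ x : ι → Fin k, (x ∘ ε.symm) ∘ ε = x := fun x => by
    rw [Function.comp_assoc, ε.symm_comp_self, Function.comp_id]
  have hquasi : ∀ L : Finset (Fin (Fintype.card ι) → Fin k), L ⊆ X' → IsQuasiline L →
      IsCombinatorialLine L ∧ ∃ e ∈ E, ∀ i, ∃ x ∈ L, π (x ∘ ε) = e i := by
    intro L hLX hL
    obtain ⟨y, hy, hyq⟩ := hL.exists_isQuasilineMap ε
    have hyL : ∀ i, y i ∈ L := fun i => by
      rw [← Finset.mem_coe, ← hy]
      exact ⟨i, rfl⟩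
    obtain ⟨m, e, he, σ, h⟩ := hX _ hyq fun i => (hX' _).1 (hLX (hyL i))
    refine ⟨isCombinatorialLine_of_range_eq ε m ?_, e, he, fun i =>
      ⟨y (σ.symm i), hyL _, by simpa using (h (σ.symm i)).2⟩⟩
    rw [← hy, ← σ.surjective.range_comp fun a => m a ∘ ε.symm]
    congr 1
    funext i
    rw [Function.comp_apply, ← (h i).1, Function.comp_assoc, ε.self_comp_symm, Function.comp_id]
  have hmono : ∀ γ : {x // x ∈ X'} → Fin r,
      ∃ (L : Finset (Fin (Fintype.card ι) → Fin k)) (hL : L ⊆ X'), IsCombinatorialLine L ∧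
        ∃ ρ : Fin r, ∀ (x : Fin (Fintype.card ι) → Fin k) (hx : x ∈ L), γ ⟨x, hL hx⟩ = ρ := by
    intro γ
    let C : (ι → Fin k) → Fin r := fun x =>
      if h : x ∘ ε.symm ∈ X' then γ ⟨x ∘ ε.symm, h⟩ else ⟨0, hr⟩
    obtain ⟨m, hm, hmC⟩ := hR C fun x _ x' _ _ h => absurd (Set.mem_univ _) h
    have hmX : ∀ a, m a ∘ ε.symm ∈ X' := fun a => (hX' _).2 (by rw [hcomp]; exact hm a)
    refine ⟨Finset.univ.image fun a => m a ∘ ε.symm, ?_,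
      isCombinatorialLine_of_range_eq ε m (by simp), C (m ⟨0, by omega⟩), ?_⟩
    · intro x hx
      obtain ⟨a, -, rfl⟩ := Finset.mem_image.1 hx
      exact hmX a
    · intro x hx
      obtain ⟨a, -, rfl⟩ := Finset.mem_image.1 hx
      rw [← hmC a]
      simp only [C, dif_pos (hmX a)]
  refine ⟨Fintype.card ι, X', ?_, hmono, ?_, fun L hLX hL => (hquasi L hLX hL).1⟩
  · obtain ⟨L, -, ⟨ℓ, -⟩, -⟩ := hmono fun _ => ⟨0, hr⟩
    obtain ⟨ν, -⟩ := ℓ.proper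
    exact Nat.one_le_of_lt ν.pos
  · intro Y hY
    -- The points whose label lies in `B ω` are deleted; a surviving quasiline would carry an edge
    -- missed by the transversal.
    obtain ⟨ω, hω⟩ := exists_mul_card_le_card_filter (fun ω x => B ω (π (x ∘ ε))) Y
      fun x _ => hμ (π (x ∘ ε))
    refine ⟨_, Finset.filter_subset _ _, hω, fun L hL hLq => ?_⟩
    obtain ⟨-, e, he, h⟩ := hquasi L ((hL.trans (Finset.filter_subset _ _)).trans hY) hLq
    obtain ⟨i, hi⟩ := hB ω e he
    obtain ⟨x, hx, hxe⟩ := h i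
    exact (Finset.mem_filter.1 (hL hx)).2 (by rw [hxe]; exact hi)
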